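/- For $\tau$ in the Siegel upper half space $\mathfrak H_2$ (symmetric complex $2\times2$ matrices with positive definite imaginary part), $a,b\in\mathbb Q^2$ and $z\in\mathbb C^2$ put $$\theta(z,\tau)=\sum_{u\in\mathbb Z^2}e^{\pi i(u^t\tau u+2u^tz)},\qquad \theta\begin{bmatrix}a\\ b\end{bmatrix}(z,\tau)=e^{\pi i(a^t\tau a+2a^t(z+b))}\,\theta(z+\tau a+b,\tau);$$ the series converges absolutely. A half-integer characteristic is $\mathfrak m=\frac12\begin{pmatrix}m_1&m_2\\ m_1'&m_2'\end{pmatrix}$ with $m_i,m_i'\in\{0,1\}$; under addition of the $m_i,m_i'$ modulo $2$ these form a group of order $16$. It is even (odd) if $m_1m_1'+m_2m_2'$ is even (odd). Its theta constant $\theta[\mathfrak m]$ is the value at $z=0$ of the theta function with characteristic $a=\frac12(m_1,m_2)^t$, $b=\frac12(m_1',m_2')^t$. Two characteristics $\mathfrak m,\mathfrak a$ are syzygetic if $\sum_i(m_i'a_i-m_ia_i')\equiv0 \pmod 2$. A Göpel group here is a subgroup of order $4$ any two elements of which are syzygetic, and its Göpel systems are its cosets. Write $\left[{m_1m_2\atop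 m_1'm_2'}\right]$ for $\mathfrak m$ and number the characteristics $$\mathfrak c_1=\left[{00\atop00}\right],\ \mathfrak c_2=\left[{00\atop11}\right],\ \mathfrak c_3=\left[{00\atop10}\right],\ \mathfrak c_4=\left[{00\atop01}\right],\ \mathfrak c_5=\left[{10\atop00}\right],\ \mathfrak c_6=\left[{10\atop01}\right],\ \mathfrak c_7=\left[{01\atop00}\right],\ \mathfrak c_8=\left[{11\atop00}\right],$$ $$\mathfrak c_9=\left[{01\atop10}\right],\ \mathfrak c_{10}=\left[{11\atop11}\right],\ \mathfrak c_{11}=\left[{01\atop01}\right],\ \mathfrak c_{12}=\left[{01\atop11}\right],\ \mathfrak c_{13}=\left[{10\atop10}\right],\ \mathfrak c_{14}=\left[{11\atop10}\right],\ \mathfrak c_{15}=\left[{10\atop11}\right],\ \mathfrak c_{16}=\left[{11\atop01}\right],$$ and let $\theta_i=\theta[\mathfrak c_i](0,\tau)$. Then the even characteristics are exactly $\mathfrak c_1,\dots,\mathfrak c_{10}$, the odd ones exactly $\mathfrak c_{11},\dots,\mathfrak c_{16}$, and there are exactly six Göpel groups consisting of even characteristics only. Each of them has four Göpel systems, of which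 every one other than the group itself contains two even and two odd characteristics. The groups, their other systems (each characteristic denoted by its number), and six identities for each group, valid for all $\tau\in\mathfrak H_2$, are as follows. (i) $G=\{1,4,3,2\}$; systems $\{5,6,13,15\},\{9,12,7,11\},\{14,10,8,16\}$; $\theta_5^2\theta_6^2=\theta_1^2\theta_4^2-\theta_2^2\theta_3^2$, $\ \theta_5^4+\theta_6^4=\theta_1^4-\theta_2^4-\theta_3^4+\theta_4^4$, $\theta_7^2\theta_9^2=\theta_1^2\theta_3^2-\theta_2^2\theta_4^2$, $\ \theta_7^4+\theta_9^4=\theta_1^4-\theta_2^4+\theta_3^4-\theta_4^4$, $\theta_8^2\theta_{10}^2=\theta_1^2\theta_2^2-\theta_3^2\theta_4^2$, $\ \theta_8^4+\theta_{10}^4=\theta_1^4+\theta_2^4-\theta_3^4-\theta_4^4$. (ii) $G=\{1,2,10,8\}$; systems $\{3,4,16,14\},\{6,13,9,11\},\{15,5,7,12\}$; $\theta_3^2\theta_4^2=\theta_1^2\theta_2^2-\theta_8^2\theta_{10}^2$, $\ \theta_3^4+\theta_4^4=\theta_1^4+\theta_2^4-\theta_8^4-\theta_{10}^4$, $\theta_6^2\theta_9^2=-\theta_1^2\theta_{10}^2+\theta_2^2\theta_8^2$,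 $\ \theta_6^4+\theta_9^4=\theta_1^4-\theta_2^4-\theta_8^4+\theta_{10}^4$, $\theta_5^2\theta_7^2=\theta_1^2\theta_8^2-\theta_2^2\theta_{10}^2$, $\ \theta_5^4+\theta_7^4=\theta_1^4-\theta_2^4+\theta_8^4-\theta_{10}^4$. (iii) $G=\{1,3,7,9\}$; systems $\{2,4,12,11\},\{8,14,5,13\},\{10,16,15,6\}$; $\theta_2^2\theta_4^2=\theta_1^2\theta_3^2-\theta_7^2\theta_9^2$, $\ \theta_2^4+\theta_4^4=\theta_1^4+\theta_3^4-\theta_7^4-\theta_9^4$, $\theta_8^2\theta_5^2=\theta_1^2\theta_7^2-\theta_3^2\theta_9^2$, $\ \theta_8^4+\theta_5^4=\theta_1^4-\theta_3^4+\theta_7^4-\theta_9^4$, $\theta_6^2\theta_{10}^2=-\theta_1^2\theta_9^2+\theta_3^2\theta_7^2$, $\ \theta_6^4+\theta_{10}^4=\theta_1^4-\theta_3^4-\theta_7^4+\theta_9^4$. (iv) $G=\{1,4,5,6\}$; systems $\{2,3,15,13\},\{8,16,7,11\},\{10,14,12,9\}$; $\theta_2^2\theta_3^2=\theta_1^2\theta_4^2-\theta_5^2\theta_6^2$,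 $\ \theta_2^4+\theta_3^4=\theta_1^4+\theta_4^4-\theta_5^4-\theta_6^4$, $\theta_8^2\theta_7^2=\theta_1^2\theta_5^2-\theta_4^2\theta_6^2$, $\ \theta_8^4+\theta_7^4=\theta_1^4-\theta_4^4+\theta_5^4-\theta_6^4$, $\theta_9^2\theta_{10}^2=-\theta_1^2\theta_6^2+\theta_4^2\theta_5^2$, $\ \theta_9^4+\theta_{10}^4=\theta_1^4-\theta_4^4-\theta_5^4+\theta_6^4$. (v) $G=\{1,5,7,8\}$; systems $\{6,4,16,11\},\{3,13,9,14\},\{15,2,10,12\}$; $\theta_4^2\theta_6^2=\theta_1^2\theta_5^2-\theta_7^2\theta_8^2$, $\ \theta_4^4+\theta_6^4=\theta_1^4+\theta_5^4-\theta_7^4-\theta_8^4$, $\theta_3^2\theta_9^2=\theta_1^2\theta_7^2-\theta_5^2\theta_8^2$, $\ \theta_3^4+\theta_9^4=\theta_1^4-\theta_5^4+\theta_7^4-\theta_8^4$, $\theta_2^2\theta_{10}^2=\theta_1^2\theta_8^2-\theta_5^2\theta_7^2$, $\ \theta_2^4+\theta_{10}^4=\theta_1^4-\theta_5^4-\theta_7^4+\theta_8^4$.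 (vi) $G=\{1,6,9,10\}$; systems $\{5,4,14,12\},\{7,16,3,15\},\{8,11,13,2\}$; $\theta_4^2\theta_5^2=\theta_1^2\theta_6^2+\theta_9^2\theta_{10}^2$, $\ \theta_4^4+\theta_5^4=\theta_1^4+\theta_6^4-\theta_9^4-\theta_{10}^4$, $\theta_3^2\theta_7^2=\theta_1^2\theta_9^2+\theta_6^2\theta_{10}^2$, $\ \theta_3^4+\theta_7^4=\theta_1^4-\theta_6^4+\theta_9^4-\theta_{10}^4$, $\theta_2^2\theta_8^2=\theta_1^2\theta_{10}^2+\theta_6^2\theta_9^2$, $\ \theta_2^4+\theta_8^4=\theta_1^4-\theta_6^4-\theta_9^4+\theta_{10}^4$. Moreover, each of these groups $G$ expresses all ten even theta constants through the four fundamental ones $\theta[\mathfrak m]$, $\mathfrak m\in G$, in the following sense: for every even $\mathfrak e$ there are forms $s,p$ of degree $4$ in four variables with integer coefficients, independent of $\tau$, such that for all $\tau\in\mathfrak H_2$ the number $\theta[\mathfrak e]^4$ is a root of $X^2-sX+p^2$, with $s,p$ evaluated at the four fundamental theta constants of $G$. -/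

import Mathlib

noncomputable section

open scoped Pointwise

/-- The Siegel upper half space: symmetric complex matrices with positive definite imaginary
part. -/
def siegelUpperHalfSpace (g : ℕ) : Set (Matrix (Fin g) (Fin g) ℂ) :=
  {τ | τ.IsSymm ∧ (τ.map Complex.im).PosDef}

/-- The term of index `u` of Riemann's theta series. -/
def riemannThetaTerm {g : ℕ} (z : Fin g → ℂ) (τ : Matrix (Fin g) (Fin g) ℂ)
    (u : Fin g → ℤ) : ℂ :=
  Complex.exp (Real.pi * Complex.I *
    ((fun i => (u i : ℂ)) ⬝ᵥ (τ.mulVec (fun i => (u i : ℂ))) + 2 * ((fun i => (u i : ℂ)) ⬝ᵥ z)))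

/-- Riemann's theta function. -/
def riemannTheta {g : ℕ} (z : Fin g → ℂ) (τ : Matrix (Fin g) (Fin g) ℂ) : ℂ :=
  ∑' u : Fin g → ℤ, riemannThetaTerm z τ u

/-- The theta function with rational characteristic `[a; b]`. -/
def thetaChar {g : ℕ} (a b : Fin g → ℚ) (z : Fin g → ℂ) (τ : Matrix (Fin g) (Fin g) ℂ) : ℂ :=
  Complex.exp (Real.pi * Complex.I *
    ((fun i => (a i : ℂ)) ⬝ᵥ (τ.mulVec (fun i => (a i : ℂ))) +
      2 * ((fun i => (a i : ℂ)) ⬝ᵥ (z + fun i => (b i : ℂ))))) *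
  riemannTheta (z + τ.mulVec (fun i => (a i : ℂ)) + fun i => (b i : ℂ)) τ

/-- The group of half-integer characteristics: `(m, m')` stands for `(1/2) [m; m']`, taken
modulo integers, so the group law is addition modulo 2. -/
abbrev HalfChar (g : ℕ) : Type := (Fin g → ZMod 2) × (Fin g → ZMod 2)

namespace HalfChar

variable {g : ℕ}

/-- `|m| = ∑ mᵢ mᵢ'` modulo 2. -/
def parity (m : HalfChar g) : ZMod 2 := ∑ i, m.1 i * m.2 i

/-- Even characteristics. -/
def IsEven (m : HalfChar g) : Prop := m.parity = 0

/-- Odd characteristics. -/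
def IsOdd (m : HalfChar g) : Prop := m.parity = 1

/-- Two characteristics are syzygetic if `|m, a| = ∑ (mᵢ' aᵢ - mᵢ aᵢ')` is zero modulo 2. -/
def Syzygetic (m a : HalfChar g) : Prop := ∑ i, (m.2 i * a.1 i - m.1 i * a.2 i) = 0

/-- A Göpel group of order `2 ^ r`. -/
def IsGoepelGroup (r : ℕ) (G : AddSubgroup (HalfChar g)) : Prop :=
  r ≤ g ∧ Nat.card G = 2 ^ r ∧ ∀ m ∈ G, ∀ a ∈ G, Syzygetic m a

/-- The Göpel systems of `G`, that is, its cosets. -/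
def goepelSystems (G : AddSubgroup (HalfChar g)) : Set (Set (HalfChar g)) :=
  {S | ∃ a : HalfChar g, S = a +ᵥ (G : Set (HalfChar g))}

/-- The theta constant `θ[m](0, τ)`, computed with the representative of `m` whose entries are
`0` or `1/2`. -/
def thetaNull (m : HalfChar g) (τ : Matrix (Fin g) (Fin g) ℂ) : ℂ :=
  thetaChar (fun i => ((m.1 i).val : ℚ) / 2) (fun i => ((m.2 i).val : ℚ) / 2) 0 τ

/-- The genus 2 characteristic with upper row `(a/2, b/2)` and lower row `(c/2, d/2)`. -/
def chr (a b c d : ZMod 2) : HalfChar 2 := (![a, b], ![c, d])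

/-- The customary numbering `1, …, 16` of the characteristics in genus 2
(the value at other numbers is not used). -/
def num : ℕ → HalfChar 2
  | 1 => chr 0 0 0 0
  | 2 => chr 0 0 1 1
  | 3 => chr 0 0 1 0
  | 4 => chr 0 0 0 1
  | 5 => chr 1 0 0 0
  | 6 => chr 1 0 0 1
  | 7 => chr 0 1 0 0
  | 8 => chr 1 1 0 0
  | 9 => chr 0 1 1 0
  | 10 => chr 1 1 1 1
  | 11 => chr 0 1 0 1
  | 12 => chr 0 1 1 1
  | 13 => chr 1 0 1 0
  | 14 => chr 1 1 1 0
  | 15 => chr 1 0 1 1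
  | 16 => chr 1 1 0 1
  | _ => 0

/-- Six groups of genus 2 characteristics, each given by two fundamental characteristics. -/
def evenGoepelGroup : Fin 6 → AddSubgroup (HalfChar 2) :=
  ![AddSubgroup.closure {num 4, num 3},
    AddSubgroup.closure {num 2, num 10},
    AddSubgroup.closure {num 3, num 7},
    AddSubgroup.closure {num 4, num 5},
    AddSubgroup.closure {num 5, num 7},
    AddSubgroup.closure {num 6, num 9}]

/-- The six identities, between ten numbers `θ 1, …, θ 10`, that belong to the `k`-th group. -/
def Identities (θ : ℕ → ℂ) : Fin 6 → Prop
  | 0 =>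
      θ 5 ^ 2 * θ 6 ^ 2 = θ 1 ^ 2 * θ 4 ^ 2 - θ 2 ^ 2 * θ 3 ^ 2 ∧
      θ 5 ^ 4 + θ 6 ^ 4 = θ 1 ^ 4 - θ 2 ^ 4 - θ 3 ^ 4 + θ 4 ^ 4 ∧
      θ 7 ^ 2 * θ 9 ^ 2 = θ 1 ^ 2 * θ 3 ^ 2 - θ 2 ^ 2 * θ 4 ^ 2 ∧
      θ 7 ^ 4 + θ 9 ^ 4 = θ 1 ^ 4 - θ 2 ^ 4 + θ 3 ^ 4 - θ 4 ^ 4 ∧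
      θ 8 ^ 2 * θ 10 ^ 2 = θ 1 ^ 2 * θ 2 ^ 2 - θ 3 ^ 2 * θ 4 ^ 2 ∧
      θ 8 ^ 4 + θ 10 ^ 4 = θ 1 ^ 4 + θ 2 ^ 4 - θ 3 ^ 4 - θ 4 ^ 4
  | 1 =>
      θ 3 ^ 2 * θ 4 ^ 2 = θ 1 ^ 2 * θ 2 ^ 2 - θ 8 ^ 2 * θ 10 ^ 2 ∧
      θ 3 ^ 4 + θ 4 ^ 4 = θ 1 ^ 4 + θ 2 ^ 4 - θ 8 ^ 4 - θ 10 ^ 4 ∧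
      θ 6 ^ 2 * θ 9 ^ 2 = -(θ 1 ^ 2 * θ 10 ^ 2) + θ 2 ^ 2 * θ 8 ^ 2 ∧
      θ 6 ^ 4 + θ 9 ^ 4 = θ 1 ^ 4 - θ 2 ^ 4 - θ 8 ^ 4 + θ 10 ^ 4 ∧
      θ 5 ^ 2 * θ 7 ^ 2 = θ 1 ^ 2 * θ 8 ^ 2 - θ 2 ^ 2 * θ 10 ^ 2 ∧
      θ 5 ^ 4 + θ 7 ^ 4 = θ 1 ^ 4 - θ 2 ^ 4 + θ 8 ^ 4 - θ 10 ^ 4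
  | 2 =>
      θ 2 ^ 2 * θ 4 ^ 2 = θ 1 ^ 2 * θ 3 ^ 2 - θ 7 ^ 2 * θ 9 ^ 2 ∧
      θ 2 ^ 4 + θ 4 ^ 4 = θ 1 ^ 4 + θ 3 ^ 4 - θ 7 ^ 4 - θ 9 ^ 4 ∧
      θ 8 ^ 2 * θ 5 ^ 2 = θ 1 ^ 2 * θ 7 ^ 2 - θ 3 ^ 2 * θ 9 ^ 2 ∧
      θ 8 ^ 4 + θ 5 ^ 4 = θ 1 ^ 4 - θ 3 ^ 4 + θ 7 ^ 4 - θ 9 ^ 4 ∧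
      θ 6 ^ 2 * θ 10 ^ 2 = -(θ 1 ^ 2 * θ 9 ^ 2) + θ 3 ^ 2 * θ 7 ^ 2 ∧
      θ 6 ^ 4 + θ 10 ^ 4 = θ 1 ^ 4 - θ 3 ^ 4 - θ 7 ^ 4 + θ 9 ^ 4
  | 3 =>
      θ 2 ^ 2 * θ 3 ^ 2 = θ 1 ^ 2 * θ 4 ^ 2 - θ 5 ^ 2 * θ 6 ^ 2 ∧
      θ 2 ^ 4 + θ 3 ^ 4 = θ 1 ^ 4 + θ 4 ^ 4 - θ 5 ^ 4 - θ 6 ^ 4 ∧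
      θ 8 ^ 2 * θ 7 ^ 2 = θ 1 ^ 2 * θ 5 ^ 2 - θ 4 ^ 2 * θ 6 ^ 2 ∧
      θ 8 ^ 4 + θ 7 ^ 4 = θ 1 ^ 4 - θ 4 ^ 4 + θ 5 ^ 4 - θ 6 ^ 4 ∧
      θ 9 ^ 2 * θ 10 ^ 2 = -(θ 1 ^ 2 * θ 6 ^ 2) + θ 4 ^ 2 * θ 5 ^ 2 ∧
      θ 9 ^ 4 + θ 10 ^ 4 = θ 1 ^ 4 - θ 4 ^ 4 - θ 5 ^ 4 + θ 6 ^ 4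
  | 4 =>
      θ 4 ^ 2 * θ 6 ^ 2 = θ 1 ^ 2 * θ 5 ^ 2 - θ 7 ^ 2 * θ 8 ^ 2 ∧
      θ 4 ^ 4 + θ 6 ^ 4 = θ 1 ^ 4 + θ 5 ^ 4 - θ 7 ^ 4 - θ 8 ^ 4 ∧
      θ 3 ^ 2 * θ 9 ^ 2 = θ 1 ^ 2 * θ 7 ^ 2 - θ 5 ^ 2 * θ 8 ^ 2 ∧
      θ 3 ^ 4 + θ 9 ^ 4 = θ 1 ^ 4 - θ 5 ^ 4 + θ 7 ^ 4 - θ 8 ^ 4 ∧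
      θ 2 ^ 2 * θ 10 ^ 2 = θ 1 ^ 2 * θ 8 ^ 2 - θ 5 ^ 2 * θ 7 ^ 2 ∧
      θ 2 ^ 4 + θ 10 ^ 4 = θ 1 ^ 4 - θ 5 ^ 4 - θ 7 ^ 4 + θ 8 ^ 4
  | 5 =>
      θ 4 ^ 2 * θ 5 ^ 2 = θ 1 ^ 2 * θ 6 ^ 2 + θ 9 ^ 2 * θ 10 ^ 2 ∧
      θ 4 ^ 4 + θ 5 ^ 4 = θ 1 ^ 4 + θ 6 ^ 4 - θ 9 ^ 4 - θ 10 ^ 4 ∧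
      θ 3 ^ 2 * θ 7 ^ 2 = θ 1 ^ 2 * θ 9 ^ 2 + θ 6 ^ 2 * θ 10 ^ 2 ∧
      θ 3 ^ 4 + θ 7 ^ 4 = θ 1 ^ 4 - θ 6 ^ 4 + θ 9 ^ 4 - θ 10 ^ 4 ∧
      θ 2 ^ 2 * θ 8 ^ 2 = θ 1 ^ 2 * θ 10 ^ 2 + θ 6 ^ 2 * θ 9 ^ 2 ∧
      θ 2 ^ 4 + θ 8 ^ 4 = θ 1 ^ 4 - θ 6 ^ 4 - θ 9 ^ 4 + θ 10 ^ 4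

/-- The value of an integral polynomial in the four fundamental theta constants `θ[m]`, where `m`
runs over the `k`-th group. -/
def evalFundamental (k : Fin 6) (P : MvPolynomial (evenGoepelGroup k) ℤ)
    (τ : Matrix (Fin 2) (Fin 2) ℂ) : ℂ :=
  MvPolynomial.eval₂ (Int.castRingHom ℂ)
    (fun m : evenGoepelGroup k => (m : HalfChar 2).thetaNull τ) P

end HalfChar

end

/-! The analytic content is one duplication formula, `thetaNull_sq`. Multiply the series of θ[m](0,
τ) by itself and replace the two summation vectors x, y by their half sum P and half difference Q.
The parallelogram law splits the exponent into a P-part and a Q-part at 2τ, and the parity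
constraint linking P and Q is resolved by a finite sum over classes σ in (Z/2)^g. So every θ[m](0,
τ)² is a quadratic form, with signs given by the lower row of m, in the theta constants at 2τ with
zero lower row.

In genus 2 there are only four such constants. After substitution, each of the 36 identities is a
polynomial identity in four independent variables.

The even characteristics outside a group G form three pairs, one in each nontrivial coset. The two
identities of a pair give the product of the squares and the sum of the fourth powers. By Vieta both
fourth powers are roots of X² - sX + p², where s is the sum and p the product of squares. For a
member of G the polynomial (X - θ⁴)² serves.

The statements on groups and cosets concern 16 elements and are checked exhaustively. Convergence
follows by comparing the series with a product of one-variable Jacobi theta series. -/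

noncomputable section
open scoped Pointwise

/-! ### Combinatorics of the sixteen characteristics. -/

namespace HalfChar

/-- The `k`-th even Göpel group as a finite set. -/
def evenGoepelFinset : Fin 6 → Finset (HalfChar 2) :=
  ![Finset.image num {1, 4, 3, 2}, Finset.image num {1, 2, 10, 8},
    Finset.image num {1, 3, 7, 9}, Finset.image num {1, 4, 5, 6},
    Finset.image num {1, 5, 7, 8}, Finset.image num {1, 6, 9, 10}]

instance {g : ℕ} (m : HalfChar g) : Decidable m.IsEven :=
  inferInstanceAs (Decidable (m.parity = 0))

instance {g : ℕ} (m : HalfChar g) : Decidable m.IsOdd :=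
  inferInstanceAs (Decidable (m.parity = 1))

instance {g : ℕ} (m a : HalfChar g) : Decidable (m.Syzygetic a) :=
  inferInstanceAs (Decidable (_ = _))

theorem add_self_eq_zero {g : ℕ} (x : HalfChar g) : x + x = 0 := by
  ext i <;> exact CharTwo.add_self_eq_zero _

/-- The subgroup generated by two characteristics. -/
theorem coe_closure_pair {g : ℕ} (x y : HalfChar g) :
    (AddSubgroup.closure {x, y} : Set (HalfChar g)) = {0, x, y, x + y} := by
  have neg_self (z : HalfChar g) : -z = z := neg_eq_of_add_eq_zero_left (add_self_eq_zero z)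
  -- The group has exponent 2, so only the parity of the multiplier matters and integer combinations
  -- of x, y give just four elements.
  have two_zsmul_self (z : HalfChar g) (n : ℤ) : n • z = 0 ∨ n • z = z := by
    rcases Int.even_or_odd' n with ⟨k, rfl | rfl⟩
    · left
      rw [mul_comm, mul_zsmul, two_zsmul, add_self_eq_zero, smul_zero]
    · right
      rw [add_zsmul, mul_comm, mul_zsmul, two_zsmul, add_self_eq_zero, smul_zero, zero_add,
        one_zsmul]
  ext z
  simp only [SetLike.mem_coe, AddSubgroup.mem_closure_pair, Set.mem_insert_iff,
    Set.mem_singleton_iff]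
  constructor
  · rintro ⟨m, n, rfl⟩
    rcases two_zsmul_self x m with h | h <;> rcases two_zsmul_self y n with h' | h' <;>
      simp [h, h']
  · rintro (rfl | rfl | rfl | rfl)
    · exact ⟨0, 0, by simp⟩
    · exact ⟨1, 0, by simp⟩
    · exact ⟨0, 1, by simp⟩
    · exact ⟨1, 1, by simp⟩

/-- Membership in a generated subgroup is not directly decidable; passing to explicit finite sets
turns the later claims into finite checks. -/
theorem coe_evenGoepelGroup (k : Fin 6) :
    (evenGoepelGroup k : Set (HalfChar 2)) = evenGoepelFinset k := by
  have pair (x y : HalfChar 2) (F : Finset (HalfChar 2)) (h : {0, x, y, x + y} = F) :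
      (AddSubgroup.closure {x, y} : Set (HalfChar 2)) = F := by
    rw [coe_closure_pair, ← h]
    simp
  fin_cases k <;> exact pair _ _ _ (by decide +kernel)

theorem mem_evenGoepelGroup {k : Fin 6} {m : HalfChar 2} :
    m ∈ evenGoepelGroup k ↔ m ∈ evenGoepelFinset k := by
  rw [← SetLike.mem_coe, coe_evenGoepelGroup, Finset.mem_coe]

theorem bijOn_num_isEven : Set.BijOn num (Set.Icc 1 10) {m | m.IsEven} := by
  have inj : ∀ i ∈ Finset.Icc 1 10, ∀ j ∈ Finset.Icc 1 10, num i = num j → i = j := by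
    decide +kernel
  refine ⟨fun i hi => ?_, fun i hi j hj h => ?_, fun m hm => ?_⟩
  · have : ∀ i ∈ Finset.Icc 1 10, (num i).IsEven := by decide +kernel
    exact this i (Finset.mem_Icc.2 hi)
  · exact inj i (Finset.mem_Icc.2 hi) j (Finset.mem_Icc.2 hj) h
  · have : ∀ m : HalfChar 2, m.IsEven → ∃ i ∈ Finset.Icc 1 10, num i = m := by decide +kernel
    obtain ⟨i, hi, h⟩ := this m hm
    exact ⟨i, Finset.mem_Icc.1 hi, h⟩

theorem bijOn_num_isOdd : Set.BijOn num (Set.Icc 11 16) {m | m.IsOdd} := by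
  have inj : ∀ i ∈ Finset.Icc 11 16, ∀ j ∈ Finset.Icc 11 16, num i = num j → i = j := by
    decide +kernel
  refine ⟨fun i hi => ?_, fun i hi j hj h => ?_, fun m hm => ?_⟩
  · have : ∀ i ∈ Finset.Icc 11 16, (num i).IsOdd := by decide +kernel
    exact this i (Finset.mem_Icc.2 hi)
  · exact inj i (Finset.mem_Icc.2 hi) j (Finset.mem_Icc.2 hj) h
  · have : ∀ m : HalfChar 2, m.IsOdd → ∃ i ∈ Finset.Icc 11 16, num i = m := by decide +kernel
    obtain ⟨i, hi, h⟩ := this m hm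
    exact ⟨i, Finset.mem_Icc.1 hi, h⟩

theorem evenGoepelGroup_injective : Function.Injective evenGoepelGroup := by
  intro k l h
  have inj : ∀ k l, evenGoepelFinset k = evenGoepelFinset l → k = l := by decide +kernel
  apply inj
  rw [← Finset.coe_inj, ← coe_evenGoepelGroup, ← coe_evenGoepelGroup, h]

/-- A subgroup of order 4 is `{0, x, y, x + y}` for some distinct nonzero `x`, `y`. -/
theorem exists_coe_eq_of_card_eq_four {g : ℕ} {G : AddSubgroup (HalfChar g)}
    (hG : Nat.card G = 4) :
    ∃ x ∈ G, ∃ y ∈ G, x ≠ 0 ∧ y ≠ 0 ∧ x ≠ y ∧ (G : Set (HalfChar g)) = {0, x, y, x + y} := by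
  have hcard : (G : Set (HalfChar g)).ncard = 4 := hG
  have hfin : (G : Set (HalfChar g)).Finite := Set.toFinite _
  obtain ⟨x, hxG, hx⟩ : ∃ x ∈ (G : Set (HalfChar g)), x ∉ ({0} : Set (HalfChar g)) :=
    Set.exists_mem_notMem_of_ncard_lt_ncard (by rw [Set.ncard_singleton]; omega)
  obtain ⟨y, hyG, hy⟩ : ∃ y ∈ (G : Set (HalfChar g)), y ∉ ({0, x} : Set (HalfChar g)) :=
    Set.exists_mem_notMem_of_ncard_lt_ncard
      (lt_of_le_of_lt (Set.ncard_insert_le _ _) (by rw [Set.ncard_singleton]; omega))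
  simp only [Set.mem_singleton_iff, Set.mem_insert_iff, not_or] at hx hy
  refine ⟨x, hxG, y, hyG, hx, hy.1, fun h => hy.2 h.symm, ?_⟩
  symm
  apply Set.eq_of_subset_of_ncard_le _ _ hfin
  · rintro z (rfl | rfl | rfl | rfl)
    exacts [G.zero_mem, hxG, hyG, G.add_mem hxG hyG]
  · have hxy : x + y ≠ 0 := fun h => hy.2 <| by
      rw [← add_left_cancel_iff (a := x), h, add_self_eq_zero]
    rw [hcard, Set.ncard_insert_of_notMem, Set.ncard_insert_of_notMem, Set.ncard_pair]
    · simpa using hx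
    · simpa [hy.1] using fun h : x = y => hy.2 h.symm
    · simpa [eq_comm, hx, hy.1] using hxy.symm

-- A group of order 4 is determined by two distinct nonzero elements, so completeness of the list
-- reduces to a check over pairs of characteristics.
set_option synthInstance.maxSize 2000 in
theorem range_evenGoepelGroup :
    Set.range evenGoepelGroup =
      {G : AddSubgroup (HalfChar 2) | IsGoepelGroup 2 G ∧ ∀ m ∈ G, m.IsEven} := by
  ext G
  constructor
  · rintro ⟨k, rfl⟩
    refine ⟨⟨le_rfl, ?_, ?_⟩, ?_⟩
    · have : ∀ k, (evenGoepelFinset k).card = 4 := by decide +kernel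
      change (evenGoepelGroup k : Set (HalfChar 2)).ncard = 4
      rw [coe_evenGoepelGroup, Set.ncard_coe_finset, this]
    · simp only [mem_evenGoepelGroup]
      revert k
      decide +kernel
    · simp only [mem_evenGoepelGroup]
      revert k
      decide +kernel
  · rintro ⟨⟨-, hcard, hsyz⟩, heven⟩
    obtain ⟨x, hx, y, hy, hx0, hy0, hxy, hG⟩ := exists_coe_eq_of_card_eq_four hcard
    -- Evenness of x + y need not be assumed: its parity is the sum of the parities of x and y and
    -- of their syzygy symbol.
    have key : ∀ x y : HalfChar 2, x ≠ 0 ∧ y ≠ 0 ∧ x ≠ y ∧ x.IsEven ∧ y.IsEven ∧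
        x.Syzygetic y → ∃ k, evenGoepelFinset k = {0, x, y, x + y} := by decide +kernel
    obtain ⟨k, hk⟩ := key x y ⟨hx0, hy0, hxy, heven x hx, heven y hy, hsyz x hx y hy⟩
    refine ⟨k, SetLike.coe_injective ?_⟩
    rw [coe_evenGoepelGroup, hk, hG]
    simp

theorem mem_goepelSystems_evenGoepelGroup {k : Fin 6} {S : Set (HalfChar 2)} :
    S ∈ goepelSystems (evenGoepelGroup k) ↔
      ∃ a : HalfChar 2, S = ((evenGoepelFinset k).image (a + ·) : Finset (HalfChar 2)) := by
  simp only [goepelSystems, Set.mem_ofPred_eq, coe_evenGoepelGroup, Finset.coe_image]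
  rfl

/-- The Göpel systems of an even Göpel group, from a finite check. -/
theorem goepelSystems_eq (k : Fin 6) (A B C D : Finset ℕ)
    (h : Finset.univ.image (fun a : HalfChar 2 => (evenGoepelFinset k).image (a + ·)) =
      {A.image num, B.image num, C.image num, D.image num}) :
    goepelSystems (evenGoepelGroup k) = {num '' A, num '' B, num '' C, num '' D} := by
  ext S
  rw [mem_goepelSystems_evenGoepelGroup]
  have mem_iff (T : Finset (HalfChar 2)) :
      (∃ a : HalfChar 2, T = (evenGoepelFinset k).image (a + ·)) ↔
        T ∈ ({A.image num, B.image num, C.image num, D.image num} : Finset _) := by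
    rw [← h]
    simp [eq_comm]
  simp only [Finset.mem_insert, Finset.mem_singleton] at mem_iff
  -- Viewing S as a finite set lets the checked equality of finite families decide membership.
  have hS : S = ((Set.toFinite S).toFinset : Finset (HalfChar 2)) := by simp
  rw [hS]
  simpa only [Set.mem_insert_iff, Set.mem_singleton_iff, ← Finset.coe_image, Finset.coe_inj]
    using mem_iff _

theorem ncard_isEven_isOdd_of_mem_goepelSystems (k : Fin 6) (S : Set (HalfChar 2))
    (hS : S ∈ goepelSystems (evenGoepelGroup k))
    (hne : S ≠ (evenGoepelGroup k : Set (HalfChar 2))) :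
    {m ∈ S | m.IsEven}.ncard = 2 ∧ {m ∈ S | m.IsOdd}.ncard = 2 := by
  obtain ⟨a, rfl⟩ := mem_goepelSystems_evenGoepelGroup.1 hS
  rw [coe_evenGoepelGroup, Ne, Finset.coe_inj] at hne
  have key : ∀ (k : Fin 6) (a : HalfChar 2),
      (evenGoepelFinset k).image (a + ·) ≠ evenGoepelFinset k →
      (((evenGoepelFinset k).image (a + ·)).filter IsEven).card = 2 ∧
      (((evenGoepelFinset k).image (a + ·)).filter IsOdd).card = 2 := by decide +kernel
  have := key k a hne
  rw [← Set.ncard_coe_finset, ← Set.ncard_coe_finset, Finset.coe_filter, Finset.coe_filter] at this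
  simpa only [Finset.mem_coe] using this

end HalfChar

/-! ### Absolute convergence of the theta series. -/

open Matrix in
/-- A positive definite real quadratic form dominates a multiple of the sum of squares. -/
theorem Matrix.PosDef.exists_mul_sum_sq_le {n : Type*} [Fintype n]
    {Y : Matrix n n ℝ} (hY : Y.PosDef) :
    ∃ c : ℝ, 0 < c ∧ ∀ x : n → ℝ, c * ∑ i, x i ^ 2 ≤ x ⬝ᵥ Y *ᵥ x := by
  rcases isEmpty_or_nonempty n with hn | hn
  · exact ⟨1, one_pos, fun x => by simp⟩
  have hcont : Continuous fun x : n → ℝ => x ⬝ᵥ Y *ᵥ x := by fun_prop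
  -- The constant comes from the minimum of the form on the unit sphere. The norm is the sup norm,
  -- so comparison with the sum of squares costs a factor equal to the dimension.
  obtain ⟨x₀, hx₀, hmin⟩ := (isCompact_sphere (0 : n → ℝ) 1).exists_isMinOn
    (NormedSpace.sphere_nonempty.2 zero_le_one) hcont.continuousOn
  have hx₀' : x₀ ≠ 0 := by
    rintro rfl
    simp at hx₀
  set c := x₀ ⬝ᵥ Y *ᵥ x₀
  have hc : 0 < c := by simpa using hY.dotProduct_mulVec_pos hx₀'
  have hcard : (0 : ℝ) < Fintype.card n := by exact_mod_cast Fintype.card_pos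
  refine ⟨c / Fintype.card n, by positivity, fun x => ?_⟩
  have hsum : ∑ i, x i ^ 2 ≤ Fintype.card n * ‖x‖ ^ 2 := by
    calc ∑ i, x i ^ 2 ≤ ∑ _i : n, ‖x‖ ^ 2 := by
          refine Finset.sum_le_sum fun i _ => ?_
          rw [← sq_abs]
          gcongr
          exact norm_le_pi_norm x i
      _ = _ := by simp
  have hle : c * ‖x‖ ^ 2 ≤ x ⬝ᵥ Y *ᵥ x := by
    rcases eq_or_ne x 0 with rfl | hx
    · simp
    have hnx : 0 < ‖x‖ := norm_pos_iff.2 hx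
    have : c ≤ (‖x‖⁻¹ • x) ⬝ᵥ Y *ᵥ (‖x‖⁻¹ • x) :=
      hmin (by simp [norm_smul, hnx.ne'])
    rw [mulVec_smul, dotProduct_smul, smul_dotProduct, smul_eq_mul, smul_eq_mul] at this
    calc c * ‖x‖ ^ 2 ≤ (‖x‖⁻¹ * (‖x‖⁻¹ * (x ⬝ᵥ Y *ᵥ x))) * ‖x‖ ^ 2 := by gcongr
      _ = _ := by field_simp
  calc c / Fintype.card n * ∑ i, x i ^ 2 ≤ c / Fintype.card n * (Fintype.card n * ‖x‖ ^ 2) := by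
        gcongr
    _ = c * ‖x‖ ^ 2 := by field_simp
    _ ≤ _ := hle

/-- A product of summable nonnegative functions of separate variables is summable. -/
theorem summable_prod_pi_of_nonneg {α : Type*} {g : ℕ} {f : Fin g → α → ℝ}
    (hf : ∀ i, Summable (f i)) (hf0 : ∀ i, 0 ≤ f i) :
    Summable fun u : Fin g → α => ∏ i, f i (u i) := by
  induction g with
  | zero => exact Summable.of_finite
  | succ g ih =>
    have h := (hf 0).mul_of_nonneg (ih (fun i => hf i.succ) (fun i => hf0 i.succ)) (hf0 0)
      (fun u => Finset.prod_nonneg fun i _ => hf0 i.succ _)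
    rw [← (Fin.consEquiv fun _ : Fin (g + 1) => α).summable_iff]
    refine h.congr fun x => ?_
    simp [Fin.consEquiv, Fin.prod_univ_succ]

open Matrix in
theorem norm_riemannThetaTerm {g : ℕ} (z : Fin g → ℂ) (τ : Matrix (Fin g) (Fin g) ℂ)
    (u : Fin g → ℤ) :
    ‖riemannThetaTerm z τ u‖ = Real.exp (-Real.pi * ((fun i => (u i : ℝ)) ⬝ᵥ
      (τ.map Complex.im *ᵥ fun i => (u i : ℝ))) - 2 * Real.pi * ∑ i, u i * (z i).im) := by
  have h : ((fun i => (u i : ℂ)) ⬝ᵥ (τ *ᵥ fun i => (u i : ℂ))).im =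
      (fun i => (u i : ℝ)) ⬝ᵥ (τ.map Complex.im *ᵥ fun i => (u i : ℝ)) := by
    simp [dotProduct, mulVec]
  have h' : ((fun i => (u i : ℂ)) ⬝ᵥ z).im = ∑ i, u i * (z i).im := by
    simp [dotProduct]
  rw [riemannThetaTerm, Complex.norm_exp, ← h, ← h']
  congr 1
  simp
  ring

/-- Riemann's theta series converges absolutely. -/
theorem summable_riemannThetaTerm {g : ℕ} {τ : Matrix (Fin g) (Fin g) ℂ}
    (hτ : τ ∈ siegelUpperHalfSpace g) (z : Fin g → ℂ) : Summable (riemannThetaTerm z τ) := by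
  obtain ⟨c, hc, hle⟩ := hτ.2.exists_mul_sum_sq_le
  -- Replacing Im τ by the smaller form c·Σ uᵢ² separates the variables: the bound is a product of
  -- Jacobi theta terms at the point ci.
  refine Summable.of_norm_bounded (g := fun u => ∏ i, ‖jacobiTheta₂_term (u i) (z i) (c * Complex.I)‖)
    (summable_prod_pi_of_nonneg (f := fun i n => ‖jacobiTheta₂_term n (z i) (c * Complex.I)‖)
      (fun i => ?_) (fun i n => norm_nonneg _)) (fun u => ?_)
  · exact ((summable_jacobiTheta₂_term_iff _ _).2 (by simpa using hc)).norm
  · simp only [norm_jacobiTheta₂_term, ← Real.exp_sum]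
    rw [norm_riemannThetaTerm, Real.exp_le_exp]
    have := mul_le_mul_of_nonneg_left (hle fun i => (u i : ℝ)) Real.pi_pos.le
    simp only [Finset.sum_sub_distrib, Finset.mul_sum] at this ⊢
    have e1 : ∑ i, -Real.pi * (u i : ℝ) ^ 2 * ((c : ℂ) * Complex.I).im =
        -∑ i, Real.pi * (c * (u i : ℝ) ^ 2) := by
      rw [← Finset.sum_neg_distrib]
      refine Finset.sum_congr rfl fun i _ => ?_
      simp
      ring
    have e2 : ∑ i, 2 * Real.pi * (u i : ℝ) * (z i).im =
        ∑ i, 2 * Real.pi * ((u i : ℝ) * (z i).im) :=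
      Finset.sum_congr rfl fun i _ => by ring
    rw [e1, e2]
    linarith


/-- Needed with r = 2, since the duplication formula passes to 2τ. -/
theorem smul_mem_siegelUpperHalfSpace {g : ℕ} {τ : Matrix (Fin g) (Fin g) ℂ} {r : ℝ} (hr : 0 < r)
    (hτ : τ ∈ siegelUpperHalfSpace g) : (r : ℂ) • τ ∈ siegelUpperHalfSpace g := by
  refine ⟨hτ.1.smul _, ?_⟩
  have h : ((r : ℂ) • τ).map Complex.im = r • τ.map Complex.im := by
    ext i j
    simp
  rw [h]
  exact hτ.2.smul hr

/-! ### The duplication formula. -/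

namespace HalfChar

variable {g : ℕ}

open Matrix in
/-- The term of index `u` of the series of the theta constant `θ[m](0, τ)`, in which the
summation runs over the translate of the lattice by the upper row of `m`. -/
def thetaNullTerm (m : HalfChar g) (τ : Matrix (Fin g) (Fin g) ℂ) (u : Fin g → ℤ) : ℂ :=
  Complex.exp (Real.pi * Complex.I *
    ((fun i => (u i : ℂ) + (m.1 i).val / 2) ⬝ᵥ τ *ᵥ (fun i => (u i : ℂ) + (m.1 i).val / 2) +
      (fun i => (u i : ℂ) + (m.1 i).val / 2) ⬝ᵥ fun i => ((m.2 i).val : ℂ)))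

-- Completing the square: with a, b the two rows of the characteristic, the prefactor and the shift
-- by τa + b combine into a form in u + a. The cross terms agree because τ is symmetric.
open Matrix in
theorem thetaNullTerm_eq {τ : Matrix (Fin g) (Fin g) ℂ} (hτ : τ.IsSymm) (m : HalfChar g)
    (u : Fin g → ℤ) :
    thetaNullTerm m τ u =
      Complex.exp (Real.pi * Complex.I *
        ((fun i => (((m.1 i).val / 2 : ℚ) : ℂ)) ⬝ᵥ τ *ᵥ (fun i => (((m.1 i).val / 2 : ℚ) : ℂ)) +
          2 * ((fun i => (((m.1 i).val / 2 : ℚ) : ℂ)) ⬝ᵥ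
            (0 + fun i => (((m.2 i).val / 2 : ℚ) : ℂ))))) *
      riemannThetaTerm (0 + τ *ᵥ (fun i => (((m.1 i).val / 2 : ℚ) : ℂ)) +
        fun i => (((m.2 i).val / 2 : ℚ) : ℂ)) τ u := by
  set a : Fin g → ℂ := fun i => (((m.1 i).val / 2 : ℚ) : ℂ) with ha
  set b : Fin g → ℂ := fun i => (((m.2 i).val / 2 : ℚ) : ℂ) with hb
  set w : Fin g → ℂ := fun i => (u i : ℂ) with hw
  have h1 : (fun i => (u i : ℂ) + (m.1 i).val / 2) = w + a := by
    ext i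
    simp [ha, hw, -ZMod.natCast_val]
  have h2 : (fun i => ((m.2 i).val : ℂ)) = (2 : ℂ) • b := by
    ext i
    simp only [hb, Pi.smul_apply, smul_eq_mul]
    push_cast
    ring
  have h3 : a ⬝ᵥ τ *ᵥ w = w ⬝ᵥ τ *ᵥ a := by
    rw [dotProduct_mulVec, dotProduct_comm, ← mulVec_transpose, hτ.eq]
  rw [thetaNullTerm, riemannThetaTerm, ← Complex.exp_add, h1, h2]
  congr 1
  simp only [mulVec_add, dotProduct_add, add_dotProduct, dotProduct_smul, zero_add, smul_eq_mul, h3]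
  ring

theorem thetaNull_eq_tsum {τ : Matrix (Fin g) (Fin g) ℂ} (hτ : τ.IsSymm) (m : HalfChar g) :
    m.thetaNull τ = ∑' u, thetaNullTerm m τ u := by
  rw [thetaNull, thetaChar, riemannTheta, ← tsum_mul_left]
  exact tsum_congr fun u => (thetaNullTerm_eq hτ m u).symm

theorem summable_thetaNullTerm {τ : Matrix (Fin g) (Fin g) ℂ} (hτ : τ ∈ siegelUpperHalfSpace g)
    (m : HalfChar g) : Summable (thetaNullTerm m τ) :=
  ((summable_riemannThetaTerm hτ _).mul_left _).congr fun u => (thetaNullTerm_eq hτ.1 m u).symm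

/-- Ensures that the halvings in the inverse map of `sumDiffEquiv` are exact. -/
theorem exists_val_add (σ α : ZMod 2) : ∃ c d : ℤ,
    (σ.val + (σ + α).val - α.val : ℤ) = 2 * c ∧ (σ.val - (σ + α).val - α.val : ℤ) = 2 * d := by
  fin_cases σ <;> fin_cases α
  exacts [⟨0, 0, rfl, rfl⟩, ⟨0, -1, rfl, rfl⟩, ⟨1, 0, rfl, rfl⟩, ⟨0, 0, rfl, rfl⟩]

/-- For `α ∈ {0, 1}`, a pair of integers `(u, v)` amounts to `(σ, n, k)`, where
`u + v + α = 2 n + σ` and `u - v = 2 k + σ'` with `σ, σ' ∈ {0, 1}` and `σ' ≡ σ + α`. -/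
def sumDiffEquiv (α : ZMod 2) : ℤ × ℤ ≃ ZMod 2 × ℤ × ℤ where
  toFun p := (((p.1 + p.2 + α.val : ℤ) : ZMod 2), (p.1 + p.2 + α.val) / 2, (p.1 - p.2) / 2)
  invFun q := (q.2.1 + q.2.2 + (q.1.val + (q.1 + α).val - α.val) / 2,
    q.2.1 - q.2.2 + (q.1.val - (q.1 + α).val - α.val) / 2)
  left_inv := by
    rintro ⟨u, v⟩
    have hcast (w : ℤ) : (((w : ZMod 2).val : ℕ) : ℤ) = w % 2 := ZMod.val_intCast w
    have hv := hcast (u + v + α.val)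
    -- The class σ + α is that of u + v + 2α, which is the parity of u - v.
    have hv' := hcast (u + v + α.val + α.val)
    rw [Int.cast_add _ (α.val : ℤ), Int.cast_natCast, ZMod.natCast_zmod_val] at hv'
    ext <;> simp only [hv, hv'] <;> omega
  right_inv := by
    rintro ⟨σ, n, k⟩
    obtain ⟨c, d, hc, hd⟩ := exists_val_add σ α
    have h1 : n + k + (σ.val + (σ + α).val - α.val) / 2 +
        (n - k + (σ.val - (σ + α).val - α.val) / 2) + α.val = 2 * n + σ.val := by omega
    have h2 : n + k + (σ.val + (σ + α).val - α.val) / 2 -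
        (n - k + (σ.val - (σ + α).val - α.val) / 2) = 2 * k + (σ + α).val := by omega
    have hσ := ZMod.val_lt σ
    have hσα := ZMod.val_lt (σ + α)
    have htwo : (2 : ZMod 2) = 0 := rfl
    simp only [h1, h2]
    refine Prod.ext ?_ (Prod.ext ?_ ?_)
    · simp [htwo]
    · dsimp only
      omega
    · dsimp only
      omega

theorem sumDiffEquiv_symm_add (α σ : ZMod 2) (n k : ℤ) :
    (((sumDiffEquiv α).symm (σ, n, k)).1 : ℂ) + α.val / 2 =
      (n + σ.val / 2) + (k + (σ + α).val / 2) := by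
  obtain ⟨c, d, hc, hd⟩ := exists_val_add σ α
  have h : 2 * ((sumDiffEquiv α).symm (σ, n, k)).1 + α.val = 2 * n + σ.val + 2 * k + (σ + α).val := by
    simp only [sumDiffEquiv, Equiv.coe_fn_symm_mk]
    omega
  have h' := congrArg (Int.cast : ℤ → ℂ) h
  simp only [Int.cast_add, Int.cast_mul, Int.cast_natCast, Int.cast_ofNat] at h'
  linear_combination h' / 2

theorem sumDiffEquiv_symm_sub (α σ : ZMod 2) (n k : ℤ) :
    (((sumDiffEquiv α).symm (σ, n, k)).2 : ℂ) + α.val / 2 =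
      (n + σ.val / 2) - (k + (σ + α).val / 2) := by
  obtain ⟨c, d, hc, hd⟩ := exists_val_add σ α
  have h : 2 * ((sumDiffEquiv α).symm (σ, n, k)).2 + α.val =
      2 * n + σ.val - (2 * k + (σ + α).val) := by
    simp only [sumDiffEquiv, Equiv.coe_fn_symm_mk]
    omega
  have h' := congrArg (Int.cast : ℤ → ℂ) h
  simp only [Int.cast_add, Int.cast_sub, Int.cast_mul, Int.cast_natCast, Int.cast_ofNat] at h'
  linear_combination h' / 2

/-- `sumDiffEquiv` in each coordinate. -/
def sumDiffEquivPi (α : Fin g → ZMod 2) :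
    (Fin g → ZMod 2) × (Fin g → ℤ) × (Fin g → ℤ) ≃ (Fin g → ℤ) × (Fin g → ℤ) :=
  (((Equiv.refl _).prodCongr (Equiv.arrowProdEquivProdArrow _ _ _).symm).trans
    (Equiv.arrowProdEquivProdArrow _ _ _).symm).trans
    ((Equiv.piCongrRight fun i => (sumDiffEquiv (α i)).symm).trans
      (Equiv.arrowProdEquivProdArrow _ _ _))

/-- `(-1) ^ (b · σ)`. -/
def signChar (b σ : Fin g → ZMod 2) : ℂ := (-1) ^ ∑ i, (b i).val * (σ i).val

open Matrix in
theorem thetaNullTerm_mul_thetaNullTerm (m : HalfChar g) (τ : Matrix (Fin g) (Fin g) ℂ)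
    (σ : Fin g → ZMod 2) (n k : Fin g → ℤ) :
    thetaNullTerm m τ (sumDiffEquivPi m.1 (σ, n, k)).1 *
      thetaNullTerm m τ (sumDiffEquivPi m.1 (σ, n, k)).2 =
    signChar m.2 σ * (thetaNullTerm (σ, 0) ((2 : ℝ) • τ) n *
      thetaNullTerm (σ + m.1, 0) ((2 : ℝ) • τ) k) := by
  set P : Fin g → ℂ := fun i => n i + (σ i).val / 2 with hP
  set Q : Fin g → ℂ := fun i => k i + (σ i + m.1 i).val / 2 with hQ
  set b : Fin g → ℂ := fun i => ((m.2 i).val : ℂ) with hb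
  have h1 : (fun i => (((sumDiffEquivPi m.1 (σ, n, k)).1 i : ℤ) : ℂ) + (m.1 i).val / 2) = P + Q :=
    funext fun i => sumDiffEquiv_symm_add (m.1 i) (σ i) (n i) (k i)
  have h2 : (fun i => (((sumDiffEquivPi m.1 (σ, n, k)).2 i : ℤ) : ℂ) + (m.1 i).val / 2) = P - Q :=
    funext fun i => sumDiffEquiv_symm_sub (m.1 i) (σ i) (n i) (k i)
  -- Here 2P = 2n + σ; the part 2n contributes a multiple of 2πi, leaving only the sign.
  have hsign : signChar m.2 σ = Complex.exp (Real.pi * Complex.I * (2 * (P ⬝ᵥ b))) := by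
    have h : Real.pi * Complex.I * (2 * (P ⬝ᵥ b)) =
        ((∑ i, (m.2 i).val * (σ i).val : ℕ) : ℂ) * (Real.pi * Complex.I) +
          ((∑ i, n i * (m.2 i).val : ℤ) : ℂ) * (2 * Real.pi * Complex.I) := by
      push_cast
      rw [dotProduct, Finset.mul_sum, Finset.mul_sum, Finset.sum_mul, Finset.sum_mul,
        ← Finset.sum_add_distrib]
      refine Finset.sum_congr rfl fun i _ => ?_
      simp only [hP, hb]
      ring
    rw [h, Complex.exp_add, Complex.exp_int_mul_two_pi_mul_I, mul_one, Complex.exp_nat_mul,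
      Complex.exp_pi_mul_I, signChar]
  rw [hsign, thetaNullTerm, thetaNullTerm, thetaNullTerm, thetaNullTerm, h1, h2,
    ← Complex.exp_add, ← Complex.exp_add, ← Complex.exp_add]
  congr 1
  simp only [Pi.add_apply, Pi.zero_apply, ZMod.val_zero, Nat.cast_zero]
  change Real.pi * Complex.I * ((P + Q) ⬝ᵥ τ *ᵥ (P + Q) + (P + Q) ⬝ᵥ b) +
    Real.pi * Complex.I * ((P - Q) ⬝ᵥ τ *ᵥ (P - Q) + (P - Q) ⬝ᵥ b) =
    Real.pi * Complex.I * (2 * (P ⬝ᵥ b)) +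
      (Real.pi * Complex.I * (P ⬝ᵥ ((2 : ℝ) • τ) *ᵥ P + P ⬝ᵥ 0) +
        Real.pi * Complex.I * (Q ⬝ᵥ ((2 : ℝ) • τ) *ᵥ Q + Q ⬝ᵥ 0))
  -- Parallelogram law: the mixed terms in P and Q cancel, and the linear terms add up to 2P·b.
  simp only [mulVec_add, mulVec_sub, dotProduct_add, dotProduct_sub, add_dotProduct,
    sub_dotProduct, smul_mulVec, dotProduct_smul, dotProduct_zero, Complex.real_smul]
  push_cast
  ring

/-- The duplication formula: the squares of the theta constants are quadratic forms in the theta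
constants with vanishing lower row at `2 τ`. -/
theorem thetaNull_sq {τ : Matrix (Fin g) (Fin g) ℂ} (hτ : τ ∈ siegelUpperHalfSpace g)
    (m : HalfChar g) :
    m.thetaNull τ ^ 2 = ∑ σ : Fin g → ZMod 2, signChar m.2 σ *
      (thetaNull (σ, 0) ((2 : ℝ) • τ) * thetaNull (σ + m.1, 0) ((2 : ℝ) • τ)) := by
  have hτ2 : (2 : ℝ) • τ ∈ siegelUpperHalfSpace g := smul_mem_siegelUpperHalfSpace two_pos hτ
  have hs := summable_thetaNullTerm hτ m
  have hprod := summable_mul_of_summable_norm hs.norm hs.norm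
  -- Absolute convergence of the double series justifies the reindexing and the split into finitely
  -- many σ.
  have hreidx := (sumDiffEquivPi m.1).summable_iff.2 hprod
  simp only [Function.comp_def] at hreidx
  rw [sq, thetaNull_eq_tsum hτ.1, tsum_mul_tsum_of_summable_norm hs.norm hs.norm,
    ← (sumDiffEquivPi m.1).tsum_eq, hreidx.tsum_prod, tsum_fintype]
  refine Finset.sum_congr rfl fun σ _ => ?_
  rw [thetaNull_eq_tsum hτ2.1, thetaNull_eq_tsum hτ2.1, tsum_mul_tsum_of_summable_norm
    (summable_thetaNullTerm hτ2 _).norm (summable_thetaNullTerm hτ2 _).norm, ← tsum_mul_left]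
  exact tsum_congr fun x => thetaNullTerm_mul_thetaNullTerm m τ σ x.1 x.2


/-! ### Genus 2: the identities. -/

theorem sum_fin_two_zmod_two {M : Type*} [AddCommMonoid M] (f : (Fin 2 → ZMod 2) → M) :
    ∑ σ, f σ = f ![0, 0] + f ![0, 1] + f ![1, 0] + f ![1, 1] := by
  have h : (Finset.univ : Finset (Fin 2 → ZMod 2)) = {![0, 0], ![0, 1], ![1, 0], ![1, 1]} := by
    decide +kernel
  rw [h, Finset.sum_insert (by decide), Finset.sum_insert (by decide),
    Finset.sum_insert (by decide), Finset.sum_singleton]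
  simp only [add_assoc]

/-- The duplication formula in genus 2, written out. -/
theorem thetaNull_chr_sq {τ : Matrix (Fin 2) (Fin 2) ℂ} (hτ : τ ∈ siegelUpperHalfSpace 2)
    (a b c d : ZMod 2) :
    (chr a b c d).thetaNull τ ^ 2 =
      (chr 0 0 0 0).thetaNull ((2 : ℝ) • τ) * (chr a b 0 0).thetaNull ((2 : ℝ) • τ) +
      (-1) ^ d.val *
        ((chr 0 1 0 0).thetaNull ((2 : ℝ) • τ) * (chr a (1 + b) 0 0).thetaNull ((2 : ℝ) • τ)) +
      (-1) ^ c.val *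
        ((chr 1 0 0 0).thetaNull ((2 : ℝ) • τ) * (chr (1 + a) b 0 0).thetaNull ((2 : ℝ) • τ)) +
      (-1) ^ (c.val + d.val) *
        ((chr 1 1 0 0).thetaNull ((2 : ℝ) • τ) *
          (chr (1 + a) (1 + b) 0 0).thetaNull ((2 : ℝ) • τ)) := by
  have h0 : (0 : Fin 2 → ZMod 2) = ![0, 0] := by decide
  have h1 : (1 : ZMod 2).val = 1 := rfl
  rw [thetaNull_sq hτ, sum_fin_two_zmod_two]
  simp [signChar, chr, h0, h1]

/-- Let A, B, C, D be the constants at 2τ with upper rows 00, 01, 10, 11. Then for instance θ₅² =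
2(AC + BD) and θ₆² = 2(AC - BD), while θ₁², …, θ₄² are signed sums of A², B², C², D². No relation
among A, B, C, D is used. -/
theorem identities_thetaNull {τ : Matrix (Fin 2) (Fin 2) ℂ} (hτ : τ ∈ siegelUpperHalfSpace 2)
    (k : Fin 6) : Identities (fun i => (num i).thetaNull τ) k := by
  have h11 : (1 + 1 : ZMod 2) = 0 := rfl
  have hv1 : (1 : ZMod 2).val = 1 := rfl
  have hpow (x : ℂ) : x ^ 4 = (x ^ 2) ^ 2 := by ring
  fin_cases k <;>
  · simp only [Identities, num, hpow, thetaNull_chr_sq hτ, h11, hv1, ZMod.val_zero, add_zero, pow_zero,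
      zero_add, pow_one]
    refine ⟨?_, ?_, ?_, ?_, ?_, ?_⟩ <;> ring

/-! ### Expressing all even theta constants through a group. -/

/-- The fourth power of `θ[e]` is a root of `X ^ 2 - s X + p ^ 2` for integral quartic forms
`s`, `p` in the theta constants of the `k`-th group. -/
def IsExpressedBy (k : Fin 6) (e : HalfChar 2) : Prop :=
  ∃ s p : MvPolynomial (evenGoepelGroup k) ℤ,
    s.IsHomogeneous 4 ∧ p.IsHomogeneous 4 ∧
    ∀ τ ∈ siegelUpperHalfSpace 2,
      (e.thetaNull τ ^ 4) ^ 2 - evalFundamental k s τ * e.thetaNull τ ^ 4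
        + evalFundamental k p τ ^ 2 = 0

open MvPolynomial in
theorem isExpressedBy_of_mem {k : Fin 6} {e : HalfChar 2} (he : e ∈ evenGoepelGroup k) :
    IsExpressedBy k e := by
  -- These forms make the quadratic the perfect square with double root θ[e]⁴.
  refine ⟨C 2 * X ⟨e, he⟩ ^ 4, X ⟨e, he⟩ ^ 4, (isHomogeneous_X_pow _ _).C_mul _,
    isHomogeneous_X_pow _ _, fun τ _ => ?_⟩
  simp only [evalFundamental, eval₂_mul, eval₂_C, eval₂_pow, eval₂_X, Int.coe_castRingHom]
  push_cast
  ring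

open MvPolynomial in
/-- Two characteristics whose theta constants satisfy a pair of identities over the `k`-th group
are expressed by this group. -/
theorem isExpressedBy_pair {k : Fin 6} {e f m₁ m₂ m₃ m₄ : HalfChar 2}
    (h₁ : m₁ ∈ evenGoepelGroup k) (h₂ : m₂ ∈ evenGoepelGroup k)
    (h₃ : m₃ ∈ evenGoepelGroup k) (h₄ : m₄ ∈ evenGoepelGroup k) (δ ε : ℤ)
    (h : ∀ τ ∈ siegelUpperHalfSpace 2,
      e.thetaNull τ ^ 2 * f.thetaNull τ ^ 2 =
        δ * (m₁.thetaNull τ ^ 2 * m₂.thetaNull τ ^ 2) +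
          ε * (m₃.thetaNull τ ^ 2 * m₄.thetaNull τ ^ 2) ∧
      e.thetaNull τ ^ 4 + f.thetaNull τ ^ 4 =
        m₁.thetaNull τ ^ 4 + m₂.thetaNull τ ^ 4 - m₃.thetaNull τ ^ 4 - m₄.thetaNull τ ^ 4) :
    IsExpressedBy k e ∧ IsExpressedBy k f := by
  set s : MvPolynomial (evenGoepelGroup k) ℤ :=
    X ⟨m₁, h₁⟩ ^ 4 + X ⟨m₂, h₂⟩ ^ 4 - X ⟨m₃, h₃⟩ ^ 4 - X ⟨m₄, h₄⟩ ^ 4 with hs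
  set p : MvPolynomial (evenGoepelGroup k) ℤ :=
    C δ * (X ⟨m₁, h₁⟩ ^ 2 * X ⟨m₂, h₂⟩ ^ 2) + C ε * (X ⟨m₃, h₃⟩ ^ 2 * X ⟨m₄, h₄⟩ ^ 2) with hp
  have hs4 : s.IsHomogeneous 4 :=
    (((isHomogeneous_X_pow _ _).add (isHomogeneous_X_pow _ _)).sub
      (isHomogeneous_X_pow _ _)).sub (isHomogeneous_X_pow _ _)
  have hp4 : p.IsHomogeneous 4 :=
    (((isHomogeneous_X_pow _ 2).mul (isHomogeneous_X_pow _ 2)).C_mul _).add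
      (((isHomogeneous_X_pow _ 2).mul (isHomogeneous_X_pow _ 2)).C_mul _)
  have hsum (τ) (hτ : τ ∈ siegelUpperHalfSpace 2) :
      evalFundamental k s τ = e.thetaNull τ ^ 4 + f.thetaNull τ ^ 4 := by
    rw [(h τ hτ).2, hs]
    simp only [evalFundamental, eval₂_add, eval₂_sub, eval₂_pow, eval₂_X]
  have hprod (τ) (hτ : τ ∈ siegelUpperHalfSpace 2) :
      evalFundamental k p τ = e.thetaNull τ ^ 2 * f.thetaNull τ ^ 2 := by
    rw [(h τ hτ).1, hp]
    simp only [evalFundamental, eval₂_add, eval₂_mul, eval₂_pow, eval₂_X, eval₂_C, Int.coe_castRingHom]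
  -- Vieta: s is the sum of the two fourth powers and p² is their product.
  constructor <;> refine ⟨s, p, hs4, hp4, fun τ hτ => ?_⟩ <;> rw [hsum τ hτ, hprod τ hτ] <;> ring


/-- A pair of identities among theta constants, as in `Identities`, yields two expressions. -/
theorem isExpressedBy_num_pair {k : Fin 6} (i j a b c d : ℕ) (δ ε : ℤ)
    (hmem : ∀ n ∈ [a, b, c, d], num n ∈ evenGoepelFinset k)
    (h : ∀ θ : ℕ → ℂ, Identities θ k →
      θ i ^ 2 * θ j ^ 2 = δ * (θ a ^ 2 * θ b ^ 2) + ε * (θ c ^ 2 * θ d ^ 2) ∧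
      θ i ^ 4 + θ j ^ 4 = θ a ^ 4 + θ b ^ 4 - θ c ^ 4 - θ d ^ 4) :
    IsExpressedBy k (num i) ∧ IsExpressedBy k (num j) := by
  have hmem' (n) (hn : n ∈ [a, b, c, d]) := mem_evenGoepelGroup.2 (hmem n hn)
  refine isExpressedBy_pair (hmem' a (by simp)) (hmem' b (by simp)) (hmem' c (by simp))
    (hmem' d (by simp)) δ ε fun τ hτ => ?_
  exact h (fun n => (num n).thetaNull τ) (identities_thetaNull hτ k)

theorem isExpressedBy_of_isEven (k : Fin 6) (e : HalfChar 2) (he : e.IsEven) :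
    IsExpressedBy k e := by
  obtain ⟨n, ⟨hn₁, hn₂⟩, rfl⟩ := bijOn_num_isEven.surjOn he
  by_cases hmem : num n ∈ evenGoepelFinset k
  · exact isExpressedBy_of_mem (mem_evenGoepelGroup.2 hmem)
  revert hmem
  -- For each group the six remaining even characteristics are paired by coset; members of the group
  -- itself are excluded by `hmem`.
  match k with
  | 0 =>
    have p5_6 := isExpressedBy_num_pair (k := 0) 5 6 1 4 2 3 1 (-1)
      (by decide +kernel) fun θ h => by
        obtain ⟨h₁, h₂, h₃, h₄, h₅, h₆⟩ := h
        push_cast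
        exact ⟨by linear_combination h₁, by linear_combination h₂⟩
    have p7_9 := isExpressedBy_num_pair (k := 0) 7 9 1 3 2 4 1 (-1)
      (by decide +kernel) fun θ h => by
        obtain ⟨h₁, h₂, h₃, h₄, h₅, h₆⟩ := h
        push_cast
        exact ⟨by linear_combination h₃, by linear_combination h₄⟩
    have p8_10 := isExpressedBy_num_pair (k := 0) 8 10 1 2 3 4 1 (-1)
      (by decide +kernel) fun θ h => by
        obtain ⟨h₁, h₂, h₃, h₄, h₅, h₆⟩ := h
        push_cast
        exact ⟨by linear_combination h₅, by linear_combination h₆⟩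
    intro hmem
    interval_cases n
    · exact absurd (by decide +kernel) hmem
    · exact absurd (by decide +kernel) hmem
    · exact absurd (by decide +kernel) hmem
    · exact absurd (by decide +kernel) hmem
    · exact p5_6.1
    · exact p5_6.2
    · exact p7_9.1
    · exact p8_10.1
    · exact p7_9.2
    · exact p8_10.2
  | 1 =>
    have p3_4 := isExpressedBy_num_pair (k := 1) 3 4 1 2 8 10 1 (-1)
      (by decide +kernel) fun θ h => by
        obtain ⟨h₁, h₂, h₃, h₄, h₅, h₆⟩ := h
        push_cast
        exact ⟨by linear_combination h₁, by linear_combination h₂⟩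
    -- The pair 1, 10 stands first because it carries the plus signs in the fourth-power identity;
    -- its product then has coefficient -1.
    have p6_9 := isExpressedBy_num_pair (k := 1) 6 9 1 10 2 8 (-1) 1
      (by decide +kernel) fun θ h => by
        obtain ⟨h₁, h₂, h₃, h₄, h₅, h₆⟩ := h
        push_cast
        exact ⟨by linear_combination h₃, by linear_combination h₄⟩
    have p5_7 := isExpressedBy_num_pair (k := 1) 5 7 1 8 2 10 1 (-1)
      (by decide +kernel) fun θ h => by
        obtain ⟨h₁, h₂, h₃, h₄, h₅, h₆⟩ := h
        push_cast
        exact ⟨by linear_combination h₅, by linear_combination h₆⟩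
    intro hmem
    interval_cases n
    · exact absurd (by decide +kernel) hmem
    · exact absurd (by decide +kernel) hmem
    · exact p3_4.1
    · exact p3_4.2
    · exact p5_7.1
    · exact p6_9.1
    · exact p5_7.2
    · exact absurd (by decide +kernel) hmem
    · exact p6_9.2
    · exact absurd (by decide +kernel) hmem
  | 2 =>
    have p2_4 := isExpressedBy_num_pair (k := 2) 2 4 1 3 7 9 1 (-1)
      (by decide +kernel) fun θ h => by
        obtain ⟨h₁, h₂, h₃, h₄, h₅, h₆⟩ := h
        push_cast
        exact ⟨by linear_combination h₁, by linear_combination h₂⟩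
    have p8_5 := isExpressedBy_num_pair (k := 2) 8 5 1 7 3 9 1 (-1)
      (by decide +kernel) fun θ h => by
        obtain ⟨h₁, h₂, h₃, h₄, h₅, h₆⟩ := h
        push_cast
        exact ⟨by linear_combination h₃, by linear_combination h₄⟩
    have p6_10 := isExpressedBy_num_pair (k := 2) 6 10 1 9 3 7 (-1) 1
      (by decide +kernel) fun θ h => by
        obtain ⟨h₁, h₂, h₃, h₄, h₅, h₆⟩ := h
        push_cast
        exact ⟨by linear_combination h₅, by linear_combination h₆⟩
    intro hmem
    interval_cases n
    · exact absurd (by decide +kernel) hmem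
    · exact p2_4.1
    · exact absurd (by decide +kernel) hmem
    · exact p2_4.2
    · exact p8_5.2
    · exact p6_10.1
    · exact absurd (by decide +kernel) hmem
    · exact p8_5.1
    · exact absurd (by decide +kernel) hmem
    · exact p6_10.2
  | 3 =>
    have p2_3 := isExpressedBy_num_pair (k := 3) 2 3 1 4 5 6 1 (-1)
      (by decide +kernel) fun θ h => by
        obtain ⟨h₁, h₂, h₃, h₄, h₅, h₆⟩ := h
        push_cast
        exact ⟨by linear_combination h₁, by linear_combination h₂⟩
    have p8_7 := isExpressedBy_num_pair (k := 3) 8 7 1 5 4 6 1 (-1)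
      (by decide +kernel) fun θ h => by
        obtain ⟨h₁, h₂, h₃, h₄, h₅, h₆⟩ := h
        push_cast
        exact ⟨by linear_combination h₃, by linear_combination h₄⟩
    have p9_10 := isExpressedBy_num_pair (k := 3) 9 10 1 6 4 5 (-1) 1
      (by decide +kernel) fun θ h => by
        obtain ⟨h₁, h₂, h₃, h₄, h₅, h₆⟩ := h
        push_cast
        exact ⟨by linear_combination h₅, by linear_combination h₆⟩
    intro hmem
    interval_cases n
    · exact absurd (by decide +kernel) hmem
    · exact p2_3.1
    · exact p2_3.2
    · exact absurd (by decide +kernel) hmem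
    · exact absurd (by decide +kernel) hmem
    · exact absurd (by decide +kernel) hmem
    · exact p8_7.2
    · exact p8_7.1
    · exact p9_10.1
    · exact p9_10.2
  | 4 =>
    have p4_6 := isExpressedBy_num_pair (k := 4) 4 6 1 5 7 8 1 (-1)
      (by decide +kernel) fun θ h => by
        obtain ⟨h₁, h₂, h₃, h₄, h₅, h₆⟩ := h
        push_cast
        exact ⟨by linear_combination h₁, by linear_combination h₂⟩
    have p3_9 := isExpressedBy_num_pair (k := 4) 3 9 1 7 5 8 1 (-1)
      (by decide +kernel) fun θ h => by
        obtain ⟨h₁, h₂, h₃, h₄, h₅, h₆⟩ := h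
        push_cast
        exact ⟨by linear_combination h₃, by linear_combination h₄⟩
    have p2_10 := isExpressedBy_num_pair (k := 4) 2 10 1 8 5 7 1 (-1)
      (by decide +kernel) fun θ h => by
        obtain ⟨h₁, h₂, h₃, h₄, h₅, h₆⟩ := h
        push_cast
        exact ⟨by linear_combination h₅, by linear_combination h₆⟩
    intro hmem
    interval_cases n
    · exact absurd (by decide +kernel) hmem
    · exact p2_10.1
    · exact p3_9.1
    · exact p4_6.1
    · exact absurd (by decide +kernel) hmem
    · exact p4_6.2
    · exact absurd (by decide +kernel) hmem
    · exact absurd (by decide +kernel) hmem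
    · exact p3_9.2
    · exact p2_10.2
  | 5 =>
    have p4_5 := isExpressedBy_num_pair (k := 5) 4 5 1 6 9 10 1 1
      (by decide +kernel) fun θ h => by
        obtain ⟨h₁, h₂, h₃, h₄, h₅, h₆⟩ := h
        push_cast
        exact ⟨by linear_combination h₁, by linear_combination h₂⟩
    have p3_7 := isExpressedBy_num_pair (k := 5) 3 7 1 9 6 10 1 1
      (by decide +kernel) fun θ h => by
        obtain ⟨h₁, h₂, h₃, h₄, h₅, h₆⟩ := h
        push_cast
        exact ⟨by linear_combination h₃, by linear_combination h₄⟩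
    have p2_8 := isExpressedBy_num_pair (k := 5) 2 8 1 10 6 9 1 1
      (by decide +kernel) fun θ h => by
        obtain ⟨h₁, h₂, h₃, h₄, h₅, h₆⟩ := h
        push_cast
        exact ⟨by linear_combination h₅, by linear_combination h₆⟩
    intro hmem
    interval_cases n
    · exact absurd (by decide +kernel) hmem
    · exact p2_8.1
    · exact p3_7.1
    · exact p4_5.1
    · exact p4_5.2
    · exact absurd (by decide +kernel) hmem
    · exact p3_7.2
    · exact p2_8.2
    · exact absurd (by decide +kernel) hmem
    · exact absurd (by decide +kernel) hmem

end HalfChar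

end
-- Assembly of the theorem.
theorem mainTheorem6 :
    -- the theta series converge (absolutely)
    (∀ τ ∈ siegelUpperHalfSpace 2, ∀ z : Fin 2 → ℂ, Summable (riemannThetaTerm z τ)) ∧
    -- the ten even and the six odd characteristics
    Set.BijOn HalfChar.num (Set.Icc 1 10) {m | m.IsEven} ∧
    Set.BijOn HalfChar.num (Set.Icc 11 16) {m | m.IsOdd} ∧
    -- there are exactly six Göpel groups of order 4 of even characteristics
    Function.Injective HalfChar.evenGoepelGroup ∧
    Set.range HalfChar.evenGoepelGroup =
      {G : AddSubgroup (HalfChar 2) | HalfChar.IsGoepelGroup 2 G ∧ ∀ m ∈ G, m.IsEven} ∧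
    -- their elements
    (HalfChar.evenGoepelGroup 0 : Set (HalfChar 2)) = HalfChar.num '' {1, 4, 3, 2} ∧
    (HalfChar.evenGoepelGroup 1 : Set (HalfChar 2)) = HalfChar.num '' {1, 2, 10, 8} ∧
    (HalfChar.evenGoepelGroup 2 : Set (HalfChar 2)) = HalfChar.num '' {1, 3, 7, 9} ∧
    (HalfChar.evenGoepelGroup 3 : Set (HalfChar 2)) = HalfChar.num '' {1, 4, 5, 6} ∧
    (HalfChar.evenGoepelGroup 4 : Set (HalfChar 2)) = HalfChar.num '' {1, 5, 7, 8} ∧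
    (HalfChar.evenGoepelGroup 5 : Set (HalfChar 2)) = HalfChar.num '' {1, 6, 9, 10} ∧
    -- their Göpel systems
    HalfChar.goepelSystems (HalfChar.evenGoepelGroup 0) =
      {HalfChar.num '' {1, 4, 3, 2}, HalfChar.num '' {5, 6, 13, 15},
       HalfChar.num '' {9, 12, 7, 11}, HalfChar.num '' {14, 10, 8, 16}} ∧
    HalfChar.goepelSystems (HalfChar.evenGoepelGroup 1) =
      {HalfChar.num '' {1, 2, 10, 8}, HalfChar.num '' {3, 4, 16, 14},
       HalfChar.num '' {6, 13, 9, 11}, HalfChar.num '' {15, 5, 7, 12}} ∧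
    HalfChar.goepelSystems (HalfChar.evenGoepelGroup 2) =
      {HalfChar.num '' {1, 3, 7, 9}, HalfChar.num '' {2, 4, 12, 11},
       HalfChar.num '' {8, 14, 5, 13}, HalfChar.num '' {10, 16, 15, 6}} ∧
    HalfChar.goepelSystems (HalfChar.evenGoepelGroup 3) =
      {HalfChar.num '' {1, 4, 5, 6}, HalfChar.num '' {2, 3, 15, 13},
       HalfChar.num '' {8, 16, 7, 11}, HalfChar.num '' {10, 14, 12, 9}} ∧
    HalfChar.goepelSystems (HalfChar.evenGoepelGroup 4) =
      {HalfChar.num '' {1, 5, 7, 8}, HalfChar.num '' {6, 4, 16, 11},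
       HalfChar.num '' {3, 13, 9, 14}, HalfChar.num '' {15, 2, 10, 12}} ∧
    HalfChar.goepelSystems (HalfChar.evenGoepelGroup 5) =
      {HalfChar.num '' {1, 6, 9, 10}, HalfChar.num '' {5, 4, 14, 12},
       HalfChar.num '' {7, 16, 3, 15}, HalfChar.num '' {8, 11, 13, 2}} ∧
    -- every system other than the group has two even and two odd members
    (∀ k : Fin 6, ∀ S ∈ HalfChar.goepelSystems (HalfChar.evenGoepelGroup k),
      S ≠ (HalfChar.evenGoepelGroup k : Set (HalfChar 2)) →
        {m ∈ S | m.IsEven}.ncard = 2 ∧ {m ∈ S | m.IsOdd}.ncard = 2) ∧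
    -- six identities for each of the six groups
    (∀ τ ∈ siegelUpperHalfSpace 2, ∀ k : Fin 6,
      HalfChar.Identities (fun i => (HalfChar.num i).thetaNull τ) k) ∧
    -- every even theta constant is expressed through the four belonging to any of the groups:
    -- its fourth power is a root of `X ^ 2 - s X + p ^ 2`, where `s` and `p` are quartic forms
    -- in these four with integral coefficients that do not depend on `τ`
    (∀ k : Fin 6, ∀ e : HalfChar 2, e.IsEven →
      ∃ s p : MvPolynomial (HalfChar.evenGoepelGroup k) ℤ,
        s.IsHomogeneous 4 ∧ p.IsHomogeneous 4 ∧
        ∀ τ ∈ siegelUpperHalfSpace 2,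
          (e.thetaNull τ ^ 4) ^ 2 - HalfChar.evalFundamental k s τ * e.thetaNull τ ^ 4
            + HalfChar.evalFundamental k p τ ^ 2 = 0) := by
  refine ⟨fun τ hτ z => summable_riemannThetaTerm hτ z, HalfChar.bijOn_num_isEven,
    HalfChar.bijOn_num_isOdd, HalfChar.evenGoepelGroup_injective, HalfChar.range_evenGoepelGroup,
    ?_, ?_, ?_, ?_, ?_, ?_, ?_, ?_, ?_, ?_, ?_, ?_,
    HalfChar.ncard_isEven_isOdd_of_mem_goepelSystems,
    fun τ hτ k => HalfChar.identities_thetaNull hτ k, HalfChar.isExpressedBy_of_isEven⟩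
  iterate 6
    · rw [HalfChar.coe_evenGoepelGroup]
      simp [HalfChar.evenGoepelFinset, Set.image_insert_eq]
  · simpa using HalfChar.goepelSystems_eq 0 {1, 4, 3, 2} {5, 6, 13, 15} {9, 12, 7, 11} {14, 10, 8, 16}
      (by decide +kernel)
  · simpa using HalfChar.goepelSystems_eq 1 {1, 2, 10, 8} {3, 4, 16, 14} {6, 13, 9, 11} {15, 5, 7, 12}
      (by decide +kernel)
  · simpa using HalfChar.goepelSystems_eq 2 {1, 3, 7, 9} {2, 4, 12, 11} {8, 14, 5, 13} {10, 16, 15, 6}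
      (by decide +kernel)
  · simpa using HalfChar.goepelSystems_eq 3 {1, 4, 5, 6} {2, 3, 15, 13} {8, 16, 7, 11} {10, 14, 12, 9}
      (by decide +kernel)
  · simpa using HalfChar.goepelSystems_eq 4 {1, 5, 7, 8} {6, 4, 16, 11} {3, 13, 9, 14} {15, 2, 10, 12}
      (by decide +kernel)
  · simpa using HalfChar.goepelSystems_eq 5 {1, 6, 9, 10} {5, 4, 14, 12} {7, 16, 3, 15} {8, 11, 13, 2}
      (by decide +kernel)
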